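/- Fix integers $m,n\ge 1$ and let $\|\cdot\|$ denote the supremum norm on $\mathbb{R}^m$ and on $\mathbb{R}^n$. A real $m\times n$ matrix $A$ is called badly approximable if there is a constant $c>0$ such that $\|A\mathbf q+\mathbf p\|\ge c\,\|\mathbf q\|^{-n/m}$ for all $\mathbf p\in\mathbb{Z}^m$ and all $\mathbf q\in\mathbb{Z}^n\setminus\{\mathbf 0\}$. Theorem. Let $A$ be a real $m\times n$ matrix. Then $A$ is badly approximable if and only if there exist constants $C$ and $Q_0$ such that for every real $Q\ge Q_0$ and every $\boldsymbol\gamma\in\mathbb{R}^m$ there exist $\mathbf p\in\mathbb{Z}^m$ and $\mathbf q\in\mathbb{Z}^n$ with $0<\|\mathbf q\|\le Q$ and $$Q^{n/m}\,\|A\mathbf q+\mathbf p+\boldsymbol\gamma\|\le C.$$ -/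

import Mathlib

/-- The image in `ℝ^k` of an integer vector. The type `Fin k → ℝ` carries the supremum norm. -/
def intVec {k : ℕ} (v : Fin k → ℤ) : Fin k → ℝ := fun i => (v i : ℝ)

/-- A real `m × n` matrix `A` is badly approximable if there is a constant `c > 0` such that
`‖A q + p‖ ≥ c ‖q‖ ^ (-n/m)` for all integer vectors `p` and all nonzero integer vectors `q`. -/
def BadlyApproximable {m n : ℕ} (A : Matrix (Fin m) (Fin n) ℝ) : Prop :=
  ∃ c : ℝ, 0 < c ∧ ∀ (p : Fin m → ℤ) (q : Fin n → ℤ), q ≠ 0 →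
    c * ‖intVec q‖ ^ (-((n : ℝ) / (m : ℝ))) ≤ ‖A.mulVec (intVec q) + intVec p‖

/-! Both directions are pigeonhole arguments. If `A` is badly approximable, the lattices of vectors
`(T (A q + p), q / Q)`, with `T = Q ^ (n/m)`, have bounded distance to every `(γ, 0)`: were it
large, some multiples `t • γ` would lie at distances 0, 1, …, J - 1, and pigeonhole on these
multiples together with a box of `q` would give either too good an approximation or two different
integers less than 1 apart (`BadlyApproximable.exists_infDist_lt`). Conversely, adding multiples of
one very good approximation `(p₀, q₀)` to the solutions for a grid of `γ` gives more integer points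
than their box can hold (`badlyApproximable_of_uniform`). -/

open Metric in
theorem infDist_range_le_add_norm {G E : Type*} [AddGroup G] [SeminormedAddCommGroup E]
    (φ : G →+ E) (x y : E) (g : G) :
    infDist x (Set.range φ) ≤ infDist y (Set.range φ) + ‖x - y + φ g‖ := by
  rw [← sub_le_iff_le_add]
  refine (le_infDist (Set.range_nonempty φ)).2 ?_
  rintro _ ⟨h, rfl⟩
  rw [sub_le_iff_le_add]
  refine (infDist_le_dist_of_mem (Set.mem_range_self (-g + h))).trans ?_
  rw [dist_eq_norm, dist_eq_norm, map_add, map_neg]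
  refine le_trans (le_of_eq ?_) (norm_add_le _ _)
  congr 1
  abel

theorem intVec_add {k : ℕ} (v w : Fin k → ℤ) : intVec (v + w) = intVec v + intVec w := by
  ext i; simp [intVec]

theorem intVec_sub {k : ℕ} (v w : Fin k → ℤ) : intVec (v - w) = intVec v - intVec w := by
  ext i; simp [intVec]

theorem intVec_nsmul {k : ℕ} (j : ℕ) (v : Fin k → ℤ) :
    intVec (j • v) = (j : ℝ) • intVec v := by
  ext i; simp [intVec]

theorem one_le_norm_intVec {k : ℕ} {v : Fin k → ℤ} (hv : v ≠ 0) : 1 ≤ ‖intVec v‖ := by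
  obtain ⟨i, hi⟩ := Function.ne_iff.1 hv
  refine le_trans ?_ (norm_le_pi_norm (intVec v) i)
  simp only [intVec, Real.norm_eq_abs]
  exact_mod_cast Int.one_le_abs hi

/-- The embedding `(p, q) ↦ (s (A q + p), t q)` of `ℤ^m × ℤ^n` in `ℝ^m × ℝ^n`. -/
noncomputable def scaledLattice {m n : ℕ} (A : Matrix (Fin m) (Fin n) ℝ) (s t : ℝ) :
    (Fin m → ℤ) × (Fin n → ℤ) →+ (Fin m → ℝ) × (Fin n → ℝ) :=
  AddMonoidHom.mk' (fun v => (s • (A.mulVec (intVec v.2) + intVec v.1), t • intVec v.2)) (by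
    intro v w
    ext i <;> simp [intVec_add, Matrix.mulVec_add] <;> ring)

theorem scaledLattice_apply {m n : ℕ} (A : Matrix (Fin m) (Fin n) ℝ) (s t : ℝ)
    (p : Fin m → ℤ) (q : Fin n → ℤ) :
    scaledLattice A s t (p, q) = (s • (A.mulVec (intVec q) + intVec p), t • intVec q) := rfl

/-- The pigeonhole principle on the torus `ℝ^m / ℤ^m` cut into `N ^ m` cubes. -/
theorem exists_ne_norm_sub_add_intVec_lt {ι : Type*} [Fintype ι] {m N : ℕ} (hN : 0 < N)
    (hcard : N ^ m < Fintype.card ι) (y : ι → Fin m → ℝ) :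
    ∃ a b : ι, a ≠ b ∧ ∃ p : Fin m → ℤ, ‖y a - y b + intVec p‖ < 1 / N := by
  have hN' : (0 : ℝ) < N := by exact_mod_cast hN
  have hlt (a : ι) (i : Fin m) : ⌊N * Int.fract (y a i)⌋₊ < N := by
    rw [Nat.floor_lt (by positivity)]
    nlinarith [Int.fract_lt_one (y a i)]
  obtain ⟨a, b, hab, h⟩ := Fintype.exists_ne_map_eq_of_card_lt
    (fun a => fun i => (⟨⌊N * Int.fract (y a i)⌋₊, hlt a i⟩ : Fin N)) (by simpa using hcard)
  refine ⟨a, b, hab, fun i => ⌊y b i⌋ - ⌊y a i⌋, ?_⟩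
  rw [pi_norm_lt_iff (by positivity)]
  intro i
  have hi : ⌊N * Int.fract (y a i)⌋₊ = ⌊N * Int.fract (y b i)⌋₊ := by
    simpa using congrFun h i
  have ha₁ := Nat.floor_le (a := N * Int.fract (y a i)) (by positivity)
  have ha₂ := Nat.lt_floor_add_one (N * Int.fract (y a i))
  have hb₁ := Nat.floor_le (a := N * Int.fract (y b i)) (by positivity)
  have hb₂ := Nat.lt_floor_add_one (N * Int.fract (y b i))
  rw [hi] at ha₁ ha₂
  have heq : (y a - y b + intVec fun i => ⌊y b i⌋ - ⌊y a i⌋) i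
      = Int.fract (y a i) - Int.fract (y b i) := by
    simp only [intVec, Pi.add_apply, Pi.sub_apply, Int.fract]
    push_cast
    ring
  rw [heq, Real.norm_eq_abs, abs_lt, neg_lt, lt_div_iff₀ hN', lt_div_iff₀ hN']
  constructor <;> linarith

theorem rpow_div_pow {m : ℕ} (n : ℕ) (hm : 1 ≤ m) {Q : ℝ} (hQ : 0 ≤ Q) :
    (Q ^ ((n : ℝ) / m)) ^ m = Q ^ n := by
  have : (m : ℝ) ≠ 0 := by exact_mod_cast (by omega : m ≠ 0)
  rw [← Real.rpow_natCast, ← Real.rpow_mul hQ, div_mul_cancel₀ _ this, Real.rpow_natCast]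

/-! ### Badly approximable implies uniform inhomogeneous approximation -/

open Metric in
/-- The covering radius of the lattices attached to a badly approximable matrix is bounded. -/
theorem BadlyApproximable.exists_infDist_lt {m n : ℕ} (hm : 1 ≤ m)
    {A : Matrix (Fin m) (Fin n) ℝ} (hA : BadlyApproximable A) :
    ∃ J : ℕ, 0 < J ∧ ∀ Q : ℝ, 1 ≤ Q → ∀ γ : Fin m → ℝ,
      infDist (γ, 0) (Set.range (scaledLattice A (Q ^ ((n : ℝ) / m)) Q⁻¹)) < J := by
  obtain ⟨c₀, hc₀, hA⟩ := hA
  obtain ⟨c, hc, hc1, hcc⟩ : ∃ c : ℝ, 0 < c ∧ c ≤ 1 ∧ c ≤ c₀ :=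
    ⟨min c₀ 1, by positivity, min_le_right _ _, min_le_left _ _⟩
  -- `J > (2 / c) ^ m` makes `J * Q ^ n` exceed the number of cubes, at most `(2 T / c) ^ m`.
  refine ⟨⌊(2 / c) ^ m⌋₊ + 1, by omega, fun Q hQ γ => ?_⟩
  set J := ⌊(2 / c) ^ m⌋₊ + 1 with hJ
  have hJ' : (2 / c) ^ m < J := by
    rw [hJ]; push_cast; exact Nat.lt_floor_add_one _
  have hQ0 : 0 < Q := by linarith
  set α : ℝ := (n : ℝ) / m with hα
  have hα0 : 0 ≤ α := by positivity
  set T := Q ^ α with hT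
  have hT1 : 1 ≤ T := Real.one_le_rpow hQ hα0
  set φ := scaledLattice A T Q⁻¹ with hφ
  by_contra! hcon
  let F : ℝ → ℝ := fun t => infDist ((t • γ, 0) : (Fin m → ℝ) × (Fin n → ℝ)) (Set.range φ)
  have hF : Continuous F := (continuous_infDist_pt _).comp (by fun_prop)
  have hF0 : F 0 = 0 := by
    refine infDist_zero_of_mem ⟨0, ?_⟩
    rw [map_zero, zero_smul, Prod.mk_zero_zero]
  have hF1 : (J : ℝ) ≤ F 1 := by simpa [F] using hcon
  have hex (j : Fin J) : ∃ t : ℝ, F t = (j : ℕ) := by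
    have hj : ((j : ℕ) : ℝ) ≤ J := by exact_mod_cast j.2.le
    obtain ⟨t, -, ht⟩ := intermediate_value_Icc zero_le_one hF.continuousOn
      (show ((j : ℕ) : ℝ) ∈ Set.Icc (F 0) (F 1) from ⟨by rw [hF0]; positivity, hj.trans hF1⟩)
    exact ⟨t, ht⟩
  choose t ht using hex
  set N := ⌈T / c⌉₊ with hN
  set H := ⌈Q⌉₊ with hH
  have hNle : T / c ≤ N := Nat.le_ceil _
  have hTc : 1 ≤ T / c := by rw [le_div_iff₀ hc]; linarith
  have hN0 : 0 < N := Nat.ceil_pos.2 (by linarith)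
  have hN0' : (0 : ℝ) < N := by exact_mod_cast hN0
  have hNub : (N : ℝ) ≤ 2 / c * T := by
    have := Nat.ceil_lt_add_one (a := T / c) (by positivity)
    have h2 : 2 / c * T = T / c + T / c := by ring
    linarith
  have hcard : N ^ m < Fintype.card (Fin J × (Fin n → Fin H)) := by
    simp only [Fintype.card_prod, Fintype.card_fin, Fintype.card_pi, Finset.prod_const,
      Finset.card_univ]
    have : (N : ℝ) ^ m < J * H ^ n := by
      calc (N : ℝ) ^ m ≤ (2 / c * T) ^ m := by gcongr
        _ = (2 / c) ^ m * Q ^ n := by rw [mul_pow, hT, rpow_div_pow n hm hQ0.le]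
        _ < J * Q ^ n := by gcongr
        _ ≤ J * H ^ n := by gcongr; exact Nat.le_ceil _
    exact_mod_cast this
  let z : (Fin n → Fin H) → Fin n → ℤ := fun q i => ((q i : ℕ) : ℤ)
  obtain ⟨⟨i, q⟩, ⟨j, r⟩, hne, p, hp⟩ := exists_ne_norm_sub_add_intVec_lt hN0 hcard
    (fun a => T⁻¹ • t a.1 • γ + A.mulVec (intVec (z a.2)))
  have hqr : ‖intVec (z q - z r)‖ < Q := by
    rw [pi_norm_lt_iff hQ0]
    intro l
    have h1 : ((q l : ℕ) : ℝ) < Q := Nat.lt_ceil.1 (q l).2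
    have h2 : ((r l : ℕ) : ℝ) < Q := Nat.lt_ceil.1 (r l).2
    have h3 : (0 : ℝ) ≤ ((q l : ℕ) : ℝ) := by positivity
    have h4 : (0 : ℝ) ≤ ((r l : ℕ) : ℝ) := by positivity
    simp only [intVec, z, Pi.sub_apply, Real.norm_eq_abs]
    push_cast
    rw [abs_lt]
    constructor <;> linarith
  have hpc : ‖T⁻¹ • (t i • γ - t j • γ) + (A.mulVec (intVec (z q - z r)) + intVec p)‖
      < c * T⁻¹ := by
    have h1 : (1 : ℝ) / N ≤ c * T⁻¹ := by
      rw [← div_eq_mul_inv, div_le_div_iff₀ hN0' (by linarith)]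
      rw [div_le_iff₀ hc] at hNle
      linarith
    refine lt_of_eq_of_lt ?_ (hp.trans_le h1)
    congr 1
    simp only [intVec_sub, Matrix.mulVec_sub, smul_sub]
    abel
  -- Equal levels leave a homogeneous approximation better than `c` allows; distinct levels give
  -- points less than 1 apart modulo the lattice, whose distances are distinct integers.
  by_cases hij : i = j
  · subst hij
    have hz : z q - z r ≠ 0 := by
      intro h
      refine hne (Prod.ext rfl (funext fun l => Fin.ext ?_))
      have := congrFun h l
      simp only [z, Pi.sub_apply, Pi.zero_apply] at this
      show (q l : ℕ) = r l
      omega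
    have h1 := hA p _ hz
    have hpos := one_le_norm_intVec hz
    have h2 : T⁻¹ ≤ ‖intVec (z q - z r)‖ ^ (-α) := by
      rw [hT, ← Real.rpow_neg hQ0.le]
      exact Real.rpow_le_rpow_of_nonpos (by linarith) hqr.le (by linarith)
    rw [sub_self, smul_zero, zero_add] at hpc
    have h3 : c * T⁻¹ ≤ c₀ * ‖intVec (z q - z r)‖ ^ (-α) := by gcongr
    linarith
  · have key : ‖((t i • γ, 0) : (Fin m → ℝ) × (Fin n → ℝ)) - (t j • γ, 0)
        + φ (p, z q - z r)‖ < 1 := by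
      rw [hφ, scaledLattice_apply]
      simp only [Prod.mk_sub_mk, Prod.mk_add_mk, sub_self, zero_add, Prod.norm_def, sup_lt_iff]
      constructor
      · have : t i • γ - t j • γ + T • (A.mulVec (intVec (z q - z r)) + intVec p)
            = T • (T⁻¹ • (t i • γ - t j • γ)
              + (A.mulVec (intVec (z q - z r)) + intVec p)) := by
          rw [smul_add T (T⁻¹ • _), smul_inv_smul₀ (by linarith)]
        rw [this, norm_smul, Real.norm_of_nonneg (by linarith)]
        calc T * _ < T * (c * T⁻¹) := by gcongr
          _ = c := by field_simp
          _ ≤ 1 := hc1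
      · rw [norm_smul, Real.norm_of_nonneg (by positivity), inv_mul_lt_iff₀ hQ0]
        linarith
    have h1 := infDist_range_le_add_norm φ (t i • γ, 0) (t j • γ, 0) (p, z q - z r)
    have h2 := infDist_range_le_add_norm φ (t j • γ, 0) (t i • γ, 0) (-(p, z q - z r))
    rw [map_neg, show ((t j • γ, 0) : (Fin m → ℝ) × (Fin n → ℝ)) - (t i • γ, 0)
      + -φ (p, z q - z r) = -((t i • γ, 0) - (t j • γ, 0) + φ (p, z q - z r)) by abel,
      norm_neg] at h2
    have hi : infDist ((t i • γ, 0) : (Fin m → ℝ) × (Fin n → ℝ)) (Set.range φ) = (i : ℕ) := ht i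
    have hj : infDist ((t j • γ, 0) : (Fin m → ℝ) × (Fin n → ℝ)) (Set.range φ) = (j : ℕ) := ht j
    rw [hi, hj] at h1 h2
    have h3 : (i : ℕ) < (j : ℕ) + 1 := by exact_mod_cast (by linarith : ((i : ℕ) : ℝ) < (j : ℕ) + 1)
    have h4 : (j : ℕ) < (i : ℕ) + 1 := by exact_mod_cast (by linarith : ((j : ℕ) : ℝ) < (i : ℕ) + 1)
    exact hij (Fin.ext (by omega))

theorem BadlyApproximable.exists_uniform {m n : ℕ} (hm : 1 ≤ m) (hn : 1 ≤ n)
    {A : Matrix (Fin m) (Fin n) ℝ} (hA : BadlyApproximable A) :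
    ∃ C Q₀ : ℝ, ∀ Q : ℝ, Q₀ ≤ Q → ∀ γ : Fin m → ℝ,
      ∃ (p : Fin m → ℤ) (q : Fin n → ℤ),
        0 < ‖intVec q‖ ∧ ‖intVec q‖ ≤ Q ∧
          Q ^ ((n : ℝ) / (m : ℝ)) * ‖A.mulVec (intVec q) + intVec p + γ‖ ≤ C := by
  obtain ⟨J, hJ, hcov⟩ := hA.exists_infDist_lt hm
  have hJ1 : (1 : ℝ) ≤ J := by exact_mod_cast hJ
  set α : ℝ := (n : ℝ) / m with hα
  refine ⟨(4 * J) ^ α * J, 4 * J, fun X hX γ => ?_⟩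
  set Q := X / (4 * J) with hQ
  have hQ1 : 1 ≤ Q := by rw [hQ, le_div_iff₀ (by positivity)]; linarith
  have hXQ : X = 4 * J * Q := by rw [hQ]; field_simp
  have hT : 0 < Q ^ α := Real.rpow_pos_of_pos (by linarith) _
  -- Shifting by `z`, of norm above `X / 4`, forces a nonzero result, since the `q` found has norm
  -- below `J * Q = X / 4`.
  let z : Fin n → ℤ := fun _ => ⌊X / 2⌋
  obtain ⟨_, ⟨⟨p, q⟩, rfl⟩, hd⟩ := (Metric.infDist_lt_iff (Set.range_nonempty _)).1
    (hcov Q hQ1 (-(Q ^ α • (γ + A.mulVec (intVec z)))))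
  rw [scaledLattice_apply, Prod.dist_eq, sup_lt_iff, dist_comm, dist_comm (0 : Fin n → ℝ),
    dist_zero_right, dist_eq_norm, sub_neg_eq_add, ← smul_add, norm_smul, norm_smul,
    Real.norm_of_nonneg hT.le, Real.norm_of_nonneg (by positivity),
    inv_mul_lt_iff₀ (by linarith)] at hd
  obtain ⟨hd1, hd2⟩ := hd
  have hfl₁ := Int.floor_le (X / 2)
  have hfl₂ := Int.lt_floor_add_one (X / 2)
  have hX4 : 4 ≤ X := by linarith
  have hfl0 : (0 : ℝ) ≤ ⌊X / 2⌋ := by linarith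
  have : Nonempty (Fin n) := ⟨⟨0, hn⟩⟩
  have hz : ‖intVec z‖ = ⌊X / 2⌋ := by
    show ‖(fun _ : Fin n => ((⌊X / 2⌋ : ℤ) : ℝ))‖ = _
    rw [pi_norm_const, Real.norm_of_nonneg hfl0]
  refine ⟨p, q + z, ?_, ?_, ?_⟩
  · have := norm_sub_le (intVec (q + z)) (intVec q)
    rw [intVec_add, add_sub_cancel_left, hz, ← intVec_add] at this
    nlinarith
  · rw [intVec_add]
    refine (norm_add_le _ _).trans ?_
    rw [hz]
    nlinarith
  · rw [hXQ, Real.mul_rpow (by positivity) (by linarith), mul_assoc]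
    gcongr
    refine le_of_eq_of_le ?_ hd1.le
    congr 2
    rw [intVec_add, Matrix.mulVec_add]
    abel

/-! ### Uniform inhomogeneous approximation implies badly approximable -/

theorem badlyApproximable_of_uniform {m n : ℕ} (hm : 1 ≤ m)
    {A : Matrix (Fin m) (Fin n) ℝ} {C Q₀ : ℝ} (h : ∀ Q : ℝ, Q₀ ≤ Q → ∀ γ : Fin m → ℝ,
      ∃ (p : Fin m → ℤ) (q : Fin n → ℤ), ‖intVec q‖ ≤ Q ∧
        Q ^ ((n : ℝ) / (m : ℝ)) * ‖A.mulVec (intVec q) + intVec p + γ‖ ≤ C) :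
    BadlyApproximable A := by
  set α : ℝ := (n : ℝ) / m with hα
  have hα0 : 0 ≤ α := by positivity
  obtain ⟨B, hB1, hCB⟩ : ∃ B : ℝ, 1 ≤ B ∧ C ≤ B := ⟨max C 1, le_max_right _ _, le_max_left _ _⟩
  -- The last bound is the final box count divided by `Q ^ n`; `K + 1` translates per grid point
  -- exceed it.
  obtain ⟨K, hK⟩ := exists_nat_ge (max (max Q₀ 1) (5 ^ n * (8 * B + 3) ^ m))
  rw [max_le_iff, max_le_iff] at hK
  obtain ⟨⟨hKQ, hK1⟩, hKB⟩ := hK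
  have hK0 : (0 : ℝ) < K := by linarith
  have hKα : 0 < (K : ℝ) ^ α := Real.rpow_pos_of_pos hK0 _
  refine ⟨B / (K * K ^ α), by positivity, fun p₀ q₀ hq₀ => ?_⟩
  by_contra! hlt
  set X := ‖intVec q₀‖ with hX
  have hX1 : 1 ≤ X := one_le_norm_intVec hq₀
  set Q := K * X with hQ
  have hQK : (K : ℝ) ≤ Q := by rw [hQ]; nlinarith
  have hQ1 : 1 ≤ Q := by linarith
  set T := Q ^ α with hT
  have hT1 : 1 ≤ T := Real.one_le_rpow hQ1 hα0
  have hsmall : K * ‖A.mulVec (intVec q₀) + intVec p₀‖ ≤ B / T := by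
    refine (mul_le_mul_of_nonneg_left hlt.le hK0.le).trans (le_of_eq ?_)
    have hXα : 0 < X ^ α := Real.rpow_pos_of_pos (by linarith) _
    rw [hT, hQ, Real.mul_rpow hK0.le (by linarith), ← hα, Real.rpow_neg (by linarith)]
    field_simp
  set N := ⌈T⌉₊ with hN
  have hNT : T ≤ N := Nat.le_ceil _
  have hNub : (N : ℝ) ≤ 2 * T := by
    have := Nat.ceil_lt_add_one (a := T) (by linarith)
    linarith
  have hN0 : (0 : ℝ) < N := by linarith
  have hex (g : Fin m → Fin N) := h Q (hKQ.trans hQK) (fun i => ((g i : ℕ) : ℝ) / N)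
  choose p q hq hpq using hex
  let u : (Fin m → Fin N) → ℕ → Fin n → ℤ := fun g k => q g + k • q₀
  -- This is `N` times the translated `p` plus `g / N`, so its residue mod `N` recovers `g`.
  let w : (Fin m → Fin N) → ℕ → Fin m → ℤ := fun g k i =>
    N * (p g + k • p₀) i + (g i : ℕ)
  have hu (g : Fin m → Fin N) (k : ℕ) (hk : k ≤ K) (i : Fin n) :
      u g k i ∈ Finset.Icc (-⌊2 * Q⌋) ⌊2 * Q⌋ := by
    have hk' : (k : ℝ) ≤ K := by exact_mod_cast hk
    have h1 : ‖intVec (u g k)‖ ≤ 2 * Q := by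
      simp only [u, intVec_add, intVec_nsmul]
      refine (norm_add_le _ _).trans ?_
      rw [norm_smul, Real.norm_of_nonneg (by positivity)]
      have : k * ‖intVec q₀‖ ≤ Q := by rw [hQ]; gcongr
      linarith [hq g]
    have h2 := (norm_le_pi_norm (intVec (u g k)) i).trans h1
    simp only [intVec, Real.norm_eq_abs, abs_le] at h2
    rw [Finset.mem_Icc, neg_le, Int.le_floor, Int.le_floor]
    push_cast
    constructor <;> linarith
  have hw (g : Fin m → Fin N) (k : ℕ) (hk : k ≤ K) (i : Fin m) :
      w g k i + ⌊N * A.mulVec (intVec (u g k)) i⌋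
        ∈ Finset.Icc (-⌊4 * B + 1⌋) ⌊4 * B + 1⌋ := by
    have hk' : (k : ℝ) ≤ K := by exact_mod_cast hk
    set γ : Fin m → ℝ := fun i => ((g i : ℕ) : ℝ) / N with hγ
    have h1 : ‖A.mulVec (intVec (u g k)) + intVec (p g + k • p₀) + γ‖ ≤ 2 * B / T := by
      have heq : A.mulVec (intVec (u g k)) + intVec (p g + k • p₀) + γ
          = (A.mulVec (intVec (q g)) + intVec (p g) + γ)
            + (k : ℝ) • (A.mulVec (intVec q₀) + intVec p₀) := by
        simp only [u, intVec_add, intVec_nsmul, Matrix.mulVec_add, Matrix.mulVec_smul, smul_add]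
        abel
      rw [heq]
      refine (norm_add_le _ _).trans ?_
      rw [norm_smul, Real.norm_of_nonneg (by positivity)]
      have e1 : ‖A.mulVec (intVec (q g)) + intVec (p g) + γ‖ ≤ B / T := by
        rw [le_div_iff₀ (by linarith)]
        linarith [hpq g]
      have e2 : k * ‖A.mulVec (intVec q₀) + intVec p₀‖ ≤ B / T :=
        le_trans (by gcongr) hsmall
      calc _ ≤ B / T + B / T := add_le_add e1 e2
        _ = 2 * B / T := by ring
    have h2 := (norm_le_pi_norm _ i).trans h1
    have h3 : |N * A.mulVec (intVec (u g k)) i + w g k i| ≤ 4 * B := by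
      have heq : N * A.mulVec (intVec (u g k)) i + w g k i
          = N * (A.mulVec (intVec (u g k)) + intVec (p g + k • p₀) + γ) i := by
        simp only [w, hγ, Pi.add_apply, intVec]
        push_cast
        field_simp
        ring
      rw [heq, abs_mul, abs_of_pos hN0]
      calc (N : ℝ) * _ ≤ (2 * T) * (2 * B / T) := by gcongr; exact h2
        _ = 4 * B := by field_simp; norm_num
    rw [abs_le] at h3
    have h4 := Int.floor_le (N * A.mulVec (intVec (u g k)) i)
    have h5 := Int.lt_floor_add_one (N * A.mulVec (intVec (u g k)) i)
    rw [Finset.mem_Icc, neg_le, Int.le_floor, Int.le_floor]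
    push_cast
    constructor <;> linarith
  have hcard := Finset.card_le_card_of_injOn
    (s := (Finset.univ : Finset ((Fin m → Fin N) × Fin (K + 1))))
    (t := Fintype.piFinset (fun _ : Fin n => Finset.Icc (-⌊2 * Q⌋) ⌊2 * Q⌋) ×ˢ
      Fintype.piFinset (fun _ : Fin m => Finset.Icc (-⌊4 * B + 1⌋) ⌊4 * B + 1⌋))
    -- The floor depends only on `u`, so the pair determines `w`, then `g`, and then `k` because `q₀
    -- ≠ 0`.
    (fun a => (u a.1 a.2, fun i => w a.1 a.2 i + ⌊N * A.mulVec (intVec (u a.1 a.2)) i⌋))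
    (by
      rintro ⟨g, k⟩ -
      have hk : (k : ℕ) ≤ K := by omega
      simp only [Finset.coe_product, Set.mem_prod, Finset.mem_coe, Fintype.mem_piFinset]
      exact ⟨hu g k hk, hw g k hk⟩)
    (by
      rintro ⟨g, k⟩ - ⟨g', k'⟩ - heq
      simp only [Prod.mk.injEq] at heq
      obtain ⟨e1, e2⟩ := heq
      have hg : g = g' := by
        funext i
        have e3 := congrFun e2 i
        rw [e1] at e3
        have e4 : w g k i = w g' k' i := by linarith
        have e5 := congrArg (· % (N : ℤ)) e4
        simp only [w, Int.mul_add_emod_self_left] at e5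
        have h1 := (g i).2
        have h2 := (g' i).2
        rw [Int.emod_eq_of_lt (by omega) (by omega), Int.emod_eq_of_lt (by omega) (by omega)] at e5
        exact Fin.ext (by omega)
      subst hg
      obtain ⟨l, hl⟩ := Function.ne_iff.1 hq₀
      have e3 := congrFun e1 l
      simp only [u, Pi.add_apply, add_right_inj, nsmul_eq_mul, Pi.mul_apply,
        Pi.natCast_apply] at e3
      have e4 := mul_right_cancel₀ hl e3
      exact Prod.ext rfl (Fin.ext (by exact_mod_cast e4)))
  simp only [Finset.card_product, Fintype.card_piFinset, Finset.prod_const, Int.card_Icc,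
    Finset.card_univ, Fintype.card_prod, Fintype.card_fin, Fintype.card_pi] at hcard
  have hbound (x : ℝ) (hx : 0 ≤ x) : ((⌊x⌋ + 1 - -⌊x⌋).toNat : ℝ) ≤ 2 * x + 1 := by
    have h0 : 0 ≤ ⌊x⌋ := Int.floor_nonneg.2 hx
    have h1 : (((⌊x⌋ + 1 - -⌊x⌋).toNat : ℤ) : ℝ) = 2 * ⌊x⌋ + 1 := by
      rw [Int.toNat_of_nonneg (by omega)]
      push_cast
      ring
    have h2 := Int.floor_le x
    rw [Int.cast_natCast] at h1
    linarith
  have hcard' : (N : ℝ) ^ m * (K + 1) ≤ (2 * (2 * Q) + 1) ^ n * (2 * (4 * B + 1) + 1) ^ m := by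
    have h1 : (N : ℝ) ^ m * (K + 1) ≤ ((⌊2 * Q⌋ + 1 - -⌊2 * Q⌋).toNat : ℝ) ^ n
        * ((⌊4 * B + 1⌋ + 1 - -⌊4 * B + 1⌋).toNat : ℝ) ^ m := by exact_mod_cast hcard
    refine h1.trans ?_
    gcongr
    · exact hbound _ (by linarith)
    · exact hbound _ (by linarith)
  have hQn : 0 < Q ^ n := by positivity
  have : Q ^ n * (K + 1) ≤ Q ^ n * (5 ^ n * (8 * B + 3) ^ m) := by
    calc Q ^ n * (K + 1) = T ^ m * (K + 1) := by rw [hT, rpow_div_pow n hm (by linarith)]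
      _ ≤ N ^ m * (K + 1) := by gcongr
      _ ≤ _ := hcard'
      _ ≤ (5 * Q) ^ n * (8 * B + 3) ^ m := by
        have h1 : 2 * (2 * Q) + 1 ≤ 5 * Q := by linarith
        have h2 : 2 * (4 * B + 1) + 1 = 8 * B + 3 := by ring
        rw [h2]
        gcongr
      _ = _ := by rw [mul_pow]; ring
  have := le_of_mul_le_mul_left this hQn
  linarith

theorem theorem2p1 (m n : ℕ) (hm : 1 ≤ m) (hn : 1 ≤ n) (A : Matrix (Fin m) (Fin n) ℝ) :
    BadlyApproximable A ↔
      ∃ C Q₀ : ℝ, ∀ Q : ℝ, Q₀ ≤ Q → ∀ γ : Fin m → ℝ,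
        ∃ (p : Fin m → ℤ) (q : Fin n → ℤ),
          0 < ‖intVec q‖ ∧ ‖intVec q‖ ≤ Q ∧
            Q ^ ((n : ℝ) / (m : ℝ)) * ‖A.mulVec (intVec q) + intVec p + γ‖ ≤ C := by
  refine ⟨fun hA => hA.exists_uniform hm hn, ?_⟩
  rintro ⟨C, Q₀, h⟩
  refine badlyApproximable_of_uniform (C := C) (Q₀ := Q₀) hm fun Q hQ γ => ?_
  obtain ⟨p, q, -, hq⟩ := h Q hQ γ
  exact ⟨p, q, hq⟩
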